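/- Let $(X,\mathscr A,\mu)$ be a $\sigma$-finite measure space and let $\phi\colon X\to X$ be an $\mathscr A$-measurable map that is nonsingular, i.e. $\mu\circ\phi^{-1}\ll\mu$. Write $\phi^n$ for the $n$-fold iterate of $\phi$ ($\phi^0=\mathrm{id}$), $\phi^{-n}(\Delta)=(\phi^n)^{-1}(\Delta)$, and let $h_{\phi^n}\colon X\to[0,\infty]$ be the Radon–Nikodym derivative of $\mu\circ(\phi^n)^{-1}$ with respect to $\mu$. For a nonsingular map $\psi$, the composition operator $C_\psi$ in the complex Hilbert space $L^2(\mu)$ has the domain $\{f\in L^2(\mu): f\circ\psi\in L^2(\mu)\}$ and acts by $C_\psi f=f\circ\psi$. For an operator $S$ in a Hilbert space $\mathcal H$, powers $S^n$ are taken with their maximal domains $\mathcal D(S^n)$ ($S^0=I$), and $\mathcal D^\infty(S)=\bigcap_{n\ge 0}\mathcal D(S^n)$ is the space of $C^\infty$-vectors of $S$. A sequence $\{\gamma_n\}_{n=0}^\infty$ of real numbers is a Stieltjes moment sequence if there is a positive Borel measure $\rho$ on $\mathbb R_+=[0,\infty)$ with $\gamma_n=\int_{\mathbb R_+}s^n\,d\rho(s)$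 for all $n\ge 0$. The operator $S$ generates Stieltjes moment sequences if $\mathcal D^\infty(S)$ is dense in $\mathcal H$ and $\{\|S^nf\|^2\}_{n=0}^\infty$ is a Stieltjes moment sequence for every $f\in\mathcal D^\infty(S)$. A vector subspace $\mathcal E\subseteq\mathcal D(S)$ is a core for $S$ if it is dense in $\mathcal D(S)$ with respect to the graph norm $(\|f\|^2+\|Sf\|^2)^{1/2}$. Then the following conditions are equivalent: (i) $C_\phi$ generates Stieltjes moment sequences; (ii) for $\mu$-a.e. $x\in X$, all $h_{\phi^n}(x)$ are finite and $\{h_{\phi^n}(x)\}_{n=0}^\infty$ is a Stieltjes moment sequence; (iii) $\mathcal D(C_\phi^k)$ is dense in $L^2(\mu)$ for every $k\ge 1$, and $\{\mu(\phi^{-n}(\Delta))\}_{n=0}^\infty$ is a Stieltjes moment sequence for every $\Delta\in\mathscr A$ such that $\mu(\phi^{-k}(\Delta))<\infty$ for all $k\ge 0$; (iv) $h_{\phi^n}<\infty$ a.e. $[\mu]$ for every $n\ge 1$, and $L(p)\ge 0$ a.e. $[\mu]$ for every complex polynomial $p\in\mathbb C[t]$ such that $p(t)\ge 0$ for all $t\in\mathbb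 R_+$, where $L$ is the linear mapping from $\mathbb C[t]$ to the space of $\mathscr A$-measurable complex functions on $X$ determined by $L(t^n)=h_{\phi^n}$, $n\ge 0$ (with each $h_{\phi^n}$ modified, by setting it to $0$ where it is infinite, so as to take values in $[0,\infty)$). Moreover, if (i) holds, then for every $n\ge 0$ we have $C_\phi^n=C_{\phi^n}$ (with equal domains), and $\mathcal D^\infty(C_\phi)$ is a core for $C_\phi^n$. -/

import Mathlib

open MeasureTheory
open scoped ENNReal NNReal ComplexOrder

noncomputable section

/-! ### Unbounded operators in a complex Hilbert space -/

section Operators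

variable {H : Type*} [NormedAddCommGroup H] [InnerProductSpace ℂ H]

/-- The product `B A` of two (partially defined) linear operators, on its maximal domain
`{f ∈ D(A) : A f ∈ D(B)}`. -/
def opMul (B A : H →ₗ.[ℂ] H) : H →ₗ.[ℂ] H where
  domain :=
    { carrier := {f | ∃ hf : f ∈ A.domain, A ⟨f, hf⟩ ∈ B.domain}
      add_mem' := by
        rintro f g ⟨hf, hf'⟩ ⟨hg, hg'⟩
        refine ⟨A.domain.add_mem hf hg, ?_⟩
        have h : A ⟨f + g, A.domain.add_mem hf hg⟩ = A ⟨f, hf⟩ + A ⟨g, hg⟩ :=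
          A.map_add ⟨f, hf⟩ ⟨g, hg⟩
        rw [h]
        exact B.domain.add_mem hf' hg'
      zero_mem' := by
        refine ⟨A.domain.zero_mem, ?_⟩
        have h : A ⟨0, A.domain.zero_mem⟩ = 0 := A.map_zero
        rw [h]
        exact B.domain.zero_mem
      smul_mem' := by
        rintro c f ⟨hf, hf'⟩
        refine ⟨A.domain.smul_mem c hf, ?_⟩
        have h : A ⟨c • f, A.domain.smul_mem c hf⟩ = c • A ⟨f, hf⟩ := A.map_smul c ⟨f, hf⟩
        rw [h]
        exact B.domain.smul_mem c hf' }
  toFun :=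
    { toFun := fun f => B ⟨A ⟨f.1, f.2.fst⟩, f.2.snd⟩
      map_add' := fun f g => by
        rw [← B.map_add]
        congr 1
        exact Subtype.ext (A.map_add ⟨f.1, f.2.fst⟩ ⟨g.1, g.2.fst⟩)
      map_smul' := fun c f => by
        rw [RingHom.id_apply, ← B.map_smul]
        congr 1
        exact Subtype.ext (A.map_smul c ⟨f.1, f.2.fst⟩) }

/-- The powers of an operator: `A⁰ = I` (everywhere defined) and `Aⁿ⁺¹ = A Aⁿ`. -/
def opPow (A : H →ₗ.[ℂ] H) : ℕ → (H →ₗ.[ℂ] H)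
  | 0 => (LinearMap.id : H →ₗ[ℂ] H).toPMap ⊤
  | n + 1 => opMul A (opPow A n)

/-- The space `D^∞(A) = ⋂ₙ D(Aⁿ)` of `C^∞`-vectors of `A`. -/
def smoothVectors (A : H →ₗ.[ℂ] H) : Submodule ℂ H :=
  ⨅ n : ℕ, (opPow A n).domain

/-- A `C^∞`-vector of `A`, as an element of the domain of `Aⁿ`. -/
def toPowDomain (A : H →ₗ.[ℂ] H) (n : ℕ) (f : smoothVectors A) : (opPow A n).domain :=
  ⟨f.1, (Submodule.mem_iInf _).1 f.2 n⟩

/-- The vector subspace `E` is a core for `A`: it is contained in `D(A)` and dense in `D(A)` with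
respect to the graph norm `‖f‖_A² = ‖f‖² + ‖A f‖²`. -/
def IsCoreFor (E : Submodule ℂ H) (A : H →ₗ.[ℂ] H) : Prop :=
  E ≤ A.domain ∧
    ∀ f : A.domain, ∀ ε : ℝ, 0 < ε →
      ∃ g : A.domain, (g : H) ∈ E ∧ √(‖((f - g : A.domain) : H)‖ ^ 2 + ‖A (f - g)‖ ^ 2) < ε

/-- A real sequence is a Stieltjes moment sequence if it is the sequence of moments of a positive
Borel measure on `ℝ₊` (all of whose moments are finite). -/
def IsStieltjesMomentSeq (γ : ℕ → ℝ) : Prop :=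
  ∃ ρ : Measure ℝ≥0,
    ∀ n : ℕ, Integrable (fun s : ℝ≥0 => (s : ℝ) ^ n) ρ ∧ γ n = ∫ s : ℝ≥0, (s : ℝ) ^ n ∂ρ

/-- A sequence in `[0, ∞]` is a Stieltjes moment sequence if all of its terms are finite and it is
one as a sequence of real numbers. -/
def IsStieltjesMomentSeqENN (γ : ℕ → ℝ≥0∞) : Prop :=
  (∀ n, γ n ≠ ∞) ∧ IsStieltjesMomentSeq fun n => (γ n).toReal

/-- `A` generates Stieltjes moment sequences: `D^∞(A)` is dense, and `‖Aⁿ f‖²` is a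
Stieltjes moment sequence for every `f ∈ D^∞(A)`. -/
def GeneratesStieltjes (A : H →ₗ.[ℂ] H) : Prop :=
  Dense (smoothVectors A : Set H) ∧
    ∀ f : smoothVectors A,
      IsStieltjesMomentSeq fun n => ‖opPow A n (toPowDomain A n f)‖ ^ 2

end Operators

/-! ### Composition operators -/

section CompositionOperators

variable {X : Type*} [MeasurableSpace X] {μ : Measure X}

/-- The composition operator `C_φ` in `L²(μ)`, with domain `{f ∈ L²(μ) : f ∘ φ ∈ L²(μ)}`.
The symbol `φ` is measurable and nonsingular (`μ ∘ φ⁻¹ ≪ μ`), which is what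
`Measure.QuasiMeasurePreserving φ μ μ` says. -/
def compositionOp {φ : X → X} (hφ : Measure.QuasiMeasurePreserving φ μ μ) :
    Lp ℂ 2 μ →ₗ.[ℂ] Lp ℂ 2 μ where
  domain :=
    { carrier := {f | MemLp (f ∘ φ) 2 μ}
      add_mem' := by
        intro f g hf hg
        have h : (⇑(f + g) ∘ φ) =ᵐ[μ] (⇑f ∘ φ) + (⇑g ∘ φ) :=
          hφ.ae_eq_comp (Lp.coeFn_add f g)
        exact (memLp_congr_ae h).2 (MemLp.add hf hg)
      zero_mem' := by
        have h : (⇑(0 : Lp ℂ 2 μ) ∘ φ) =ᵐ[μ] (0 : X → ℂ) :=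
          hφ.ae_eq_comp (Lp.coeFn_zero ℂ 2 μ)
        exact (memLp_congr_ae h).2 MemLp.zero
      smul_mem' := by
        intro c f hf
        have h : (⇑(c • f) ∘ φ) =ᵐ[μ] c • (⇑f ∘ φ) :=
          hφ.ae_eq_comp (Lp.coeFn_smul c f)
        exact (memLp_congr_ae h).2 (MemLp.const_smul hf c) }
  toFun :=
    { toFun := fun f => MemLp.toLp (f.1 ∘ φ) f.2
      map_add' := fun f g => by
        rw [← MemLp.toLp_add]
        exact MemLp.toLp_congr _ _ (hφ.ae_eq_comp (Lp.coeFn_add f.1 g.1))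
      map_smul' := fun c f => by
        rw [RingHom.id_apply, ← MemLp.toLp_const_smul]
        exact MemLp.toLp_congr _ _ (hφ.ae_eq_comp (Lp.coeFn_smul c f.1)) }

/-- The Radon–Nikodym derivative `h_{φⁿ} = d(μ ∘ (φⁿ)⁻¹)/dμ : X → [0, ∞]`, where `φⁿ` is the
`n`-fold iterate of `φ`. -/
def rnIter (μ : Measure X) (φ : X → X) (n : ℕ) : X → ℝ≥0∞ :=
  (μ.map φ^[n]).rnDeriv μ

theorem measurable_rnIter (μ : Measure X) (φ : X → X) (n : ℕ) : Measurable (rnIter μ φ n) :=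
  Measure.measurable_rnDeriv _ _

/-- The defining property of `h_{φⁿ}`; the measure `μ ∘ φ⁻ⁿ` need not be `σ`-finite here. -/
theorem lintegral_rnIter [SigmaFinite μ] {φ : X → X}
    (hφ : Measure.QuasiMeasurePreserving φ μ μ) (n : ℕ) {s : Set X} (hs : MeasurableSet s) :
    ∫⁻ x in s, rnIter μ φ n x ∂μ = μ (φ^[n] ⁻¹' s) := by
  have h : μ.withDensity (rnIter μ φ n) = μ.map φ^[n] :=
    Measure.withDensity_rnDeriv_eq _ _ (hφ.iterate n).absolutelyContinuous
  rw [← withDensity_apply _ hs, h, Measure.map_apply (hφ.iterate n).measurable hs]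

/-- The vector space of measurable complex functions on `X`. -/
def measurableFunctions (X : Type*) [MeasurableSpace X] : Submodule ℂ (X → ℂ) where
  carrier := {f | Measurable f}
  add_mem' := fun hf hg => Measurable.add hf hg
  zero_mem' := measurable_const
  smul_mem' := fun c _ hf => Measurable.const_smul hf c

/-- The version of `h_{φⁿ}` with values in `[0, ∞)` that is obtained by replacing the value `∞`
by `0`; when `h_{φⁿ} < ∞` almost everywhere, this is a modification on a null set. -/
def rnIterFinite (μ : Measure X) (φ : X → X) (n : ℕ) : measurableFunctions X :=
  ⟨fun x => (((rnIter μ φ n x).toReal : ℝ) : ℂ),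
    Complex.measurable_ofReal.comp (measurable_rnIter μ φ n).ennreal_toReal⟩

/-- The linear mapping `L` from the complex polynomials to the measurable complex functions that
is determined by `L(tⁿ) = h_{φⁿ}`. -/
def momentMap (μ : Measure X) (φ : X → X) : Polynomial ℂ →ₗ[ℂ] measurableFunctions X :=
  (Polynomial.basisMonomials ℂ).constr ℂ (rnIterFinite μ φ)

theorem momentMap_X_pow (μ : Measure X) (φ : X → X) (n : ℕ) :
    momentMap μ φ (Polynomial.X ^ n) = rnIterFinite μ φ n := by
  rw [Polynomial.X_pow_eq_monomial]
  exact (Polynomial.basisMonomials ℂ).constr_basis ℂ (rnIterFinite μ φ) n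

end CompositionOperators

end

/-!
Let `h n = h_{φⁿ}`. A change of variables gives `‖C_φⁿ f‖² = ∫ |f|² h n dμ` for `f ∈ D(C_φⁿ)`
(`norm_opPow_sq`), and `D(C_φⁿ)` consists of the `f` for which the integrals of `|f|² h j`, `j ≤ n`,
are finite (`mem_domain_opPow_iff`). All the equivalences then reduce to one principle: a real
sequence is a Stieltjes moment sequence if and only if its moment functional `tⁿ ↦ γ n` is
nonnegative on the polynomials that are nonnegative on the half-line. The nontrivial direction,
`IsPositiveOnHalfLine.isStieltjesMomentSeq`, is the Riesz–Haviland theorem: the functional is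
extended by M. Riesz's theorem to the functions dominated by polynomials, the extension is
represented by a measure on the compactly supported continuous functions, and cut-offs show that
the measure has the right moments.

Positivity, unlike the choice of a representing measure, passes freely between points and integrals.
From `h n x` to integrals against `|f|² dμ` it passes by linearity
(`isStieltjesMomentSeq_lintegral`).
Conversely, if `{μ(φ⁻ⁿ(Δ))}` is a Stieltjes moment sequence for all `Δ` with finite entries, then
for every admissible polynomial the functional of `h n x` is nonnegative for almost every `x`: the
function has nonnegative integrals over the subsets of an exhausting sequence of sets on which all
`h n` are integrable (`exists_exhaustion`). The exceptional null set can be chosen independently of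
the polynomial, because polynomials with rational coefficients suffice
(`isPositiveOnHalfLine_of_rat`).

Density of `D(C_φᵏ)` forces `h k < ∞` almost everywhere (`ae_rnIter_lt_top_of_dense`). If all the
`h n` are finite almost everywhere, truncation to the exhausting sets yields the density of
`D^∞(C_φ)` and the core property (`exists_smoothVector_approx`). Finally, `sʲ ≤ 1 + sⁿ` for `j ≤ n`
gives `h j ≤ h 0 + h n`, and hence `D(C_{φⁿ}) ⊆ D(C_φⁿ)` (`opPow_eq_compositionOp_iterate`).
-/

/-! ### The Stieltjes moment problem -/

/-- The linear functional on the real polynomials which sends `tⁿ` to `γ n`. -/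
noncomputable def momentFunctional (γ : ℕ → ℝ) : Polynomial ℝ →ₗ[ℝ] ℝ :=
  (Polynomial.basisMonomials ℝ).constr ℝ γ

theorem momentFunctional_apply (γ : ℕ → ℝ) (p : Polynomial ℝ) :
    momentFunctional γ p = ∑ n ∈ p.support, p.coeff n * γ n := by
  rw [momentFunctional, Module.Basis.constr_apply]
  rfl

theorem momentFunctional_X_pow (γ : ℕ → ℝ) (n : ℕ) :
    momentFunctional γ (Polynomial.X ^ n) = γ n := by
  rw [Polynomial.X_pow_eq_monomial]
  exact (Polynomial.basisMonomials ℝ).constr_basis ℝ γ n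

/-- The condition of M. Riesz on a sequence: its moment functional is nonnegative on the
polynomials that are nonnegative on the half-line. -/
def IsPositiveOnHalfLine (γ : ℕ → ℝ) : Prop :=
  ∀ p : Polynomial ℝ, (∀ t : ℝ, 0 ≤ t → 0 ≤ p.eval t) → 0 ≤ momentFunctional γ p

/-- The functions on the half-line that are dominated by a polynomial. -/
def polynomiallyBounded : Submodule ℝ (ℝ≥0 → ℝ) where
  carrier := {f | ∃ p : Polynomial ℝ, ∀ t : ℝ≥0, |f t| ≤ p.eval (t : ℝ)}
  add_mem' := by
    rintro f g ⟨p, hp⟩ ⟨q, hq⟩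
    refine ⟨p + q, fun t => ?_⟩
    rw [Polynomial.eval_add]
    exact (abs_add_le _ _).trans (add_le_add (hp t) (hq t))
  zero_mem' := ⟨0, fun t => by simp⟩
  smul_mem' := by
    rintro c f ⟨p, hp⟩
    refine ⟨Polynomial.C |c| * p, fun t => ?_⟩
    rw [Polynomial.eval_mul, Polynomial.eval_C, Pi.smul_apply, smul_eq_mul, abs_mul]
    exact mul_le_mul_of_nonneg_left (hp t) (abs_nonneg c)

/-- Since `|p(t)| ≤ 1 + p(t)²`, a polynomial function is dominated by a polynomial. -/
theorem eval_mem_polynomiallyBounded (p : Polynomial ℝ) :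
    (fun t : ℝ≥0 => p.eval (t : ℝ)) ∈ polynomiallyBounded := by
  refine ⟨1 + p ^ 2, fun t => ?_⟩
  simp only [Polynomial.eval_add, Polynomial.eval_one, Polynomial.eval_pow]
  rw [abs_le]
  constructor <;> nlinarith [sq_nonneg (p.eval (t : ℝ) + 1), sq_nonneg (p.eval (t : ℝ) - 1)]

/-- Restriction of polynomials to the half-line. -/
def polynomialToFunction : Polynomial ℝ →ₗ[ℝ] polynomiallyBounded where
  toFun p := ⟨fun t => p.eval (t : ℝ), eval_mem_polynomiallyBounded p⟩
  map_add' p q := by ext t; simp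
  map_smul' c p := by ext t; simp

theorem polynomialToFunction_injective : Function.Injective polynomialToFunction := by
  intro p q h
  refine Polynomial.eq_of_infinite_eval_eq p q ((Set.Ici_infinite (0 : ℝ)).mono fun t ht => ?_)
  exact congrFun (congrArg Subtype.val h) ⟨t, ht⟩

/-- M. Riesz extension: a functional that is positive on polynomials extends to a positive
functional on all polynomially bounded functions. -/
theorem exists_positive_extension {γ : ℕ → ℝ} (hγ : IsPositiveOnHalfLine γ) :
    ∃ g : polynomiallyBounded →ₗ[ℝ] ℝ,
      (∀ p, g (polynomialToFunction p) = momentFunctional γ p) ∧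
        ∀ f : polynomiallyBounded, (∀ t, 0 ≤ (f : ℝ≥0 → ℝ) t) → 0 ≤ g f := by
  let s : PointedCone ℝ polynomiallyBounded :=
    { carrier := {f | ∀ t, 0 ≤ (f : ℝ≥0 → ℝ) t}
      add_mem' := fun hf hg t => add_nonneg (hf t) (hg t)
      zero_mem' := fun t => le_rfl
      smul_mem' := fun c f hf t => mul_nonneg c.2 (hf t) }
  let e := LinearEquiv.ofInjective polynomialToFunction polynomialToFunction_injective
  let F : polynomiallyBounded →ₗ.[ℝ] ℝ :=
    ⟨LinearMap.range polynomialToFunction, momentFunctional γ ∘ₗ e.symm.toLinearMap⟩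
  have hF : ∀ p (h : polynomialToFunction p ∈ F.domain),
      F ⟨polynomialToFunction p, h⟩ = momentFunctional γ p := by
    intro p h
    have : e.symm ⟨polynomialToFunction p, h⟩ = p := by
      rw [LinearEquiv.symm_apply_eq]
      rfl
    exact congrArg (momentFunctional γ) this
  obtain ⟨g, hg, hpos⟩ := riesz_extension s F
    (by
      rintro ⟨_, p, rfl⟩ hx
      exact (hγ p fun t ht => hx ⟨t, ht⟩).trans_eq (hF p ⟨p, rfl⟩).symm)
    (by
      rintro ⟨f, p, hp⟩
      refine ⟨⟨polynomialToFunction p, p, rfl⟩, fun t => ?_⟩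
      change 0 ≤ p.eval (t : ℝ) + f t
      linarith [neg_abs_le (f t), hp t])
  exact ⟨g, fun p => (hg ⟨_, p, rfl⟩).trans (hF p _), fun f hf => hpos f hf⟩

/-- A continuous cut-off on the half-line: it is `1` on `[0, k]` and `0` on `[k + 1, ∞)`. -/
noncomputable def halfLineCutoff (k : ℕ) (t : ℝ≥0) : ℝ := max 0 (min 1 (k + 1 - t))

theorem halfLineCutoff_nonneg (k : ℕ) (t : ℝ≥0) : 0 ≤ halfLineCutoff k t := le_max_left _ _

theorem halfLineCutoff_le_one (k : ℕ) (t : ℝ≥0) : halfLineCutoff k t ≤ 1 :=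
  max_le zero_le_one (min_le_left _ _)

theorem halfLineCutoff_eq_one {k : ℕ} {t : ℝ≥0} (h : (t : ℝ) ≤ k) : halfLineCutoff k t = 1 := by
  rw [halfLineCutoff, min_eq_left (by linarith), max_eq_right zero_le_one]

theorem halfLineCutoff_eq_zero {k : ℕ} {t : ℝ≥0} (h : (k : ℝ) + 1 ≤ t) :
    halfLineCutoff k t = 0 :=
  max_eq_left ((min_le_right _ _).trans (by linarith))

theorem halfLineCutoff_mono (t : ℝ≥0) : Monotone fun k => halfLineCutoff k t := by
  intro k l hkl
  have : (k : ℝ) ≤ l := by exact_mod_cast hkl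
  exact max_le_max le_rfl (min_le_min le_rfl (by linarith))

theorem continuous_halfLineCutoff (k : ℕ) : Continuous (halfLineCutoff k) := by
  unfold halfLineCutoff
  fun_prop

/-- The truncated monomial `tⁿ η_k(t)`, as a compactly supported continuous function. -/
noncomputable def truncatedMonomial (n k : ℕ) : CompactlySupportedContinuousMap ℝ≥0 ℝ where
  toFun t := (t : ℝ) ^ n * halfLineCutoff k t
  continuous_toFun := by
    have := continuous_halfLineCutoff k
    fun_prop
  hasCompactSupport' := by
    refine HasCompactSupport.intro (isCompact_Icc (a := (0 : ℝ≥0)) (b := k + 1)) fun t ht => ?_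
    have h : (k : ℝ≥0) + 1 ≤ t := by
      by_contra h
      exact ht ⟨zero_le, (not_le.1 h).le⟩
    rw [halfLineCutoff_eq_zero (by exact_mod_cast h), mul_zero]

theorem truncatedMonomial_apply (n k : ℕ) (t : ℝ≥0) :
    truncatedMonomial n k t = (t : ℝ) ^ n * halfLineCutoff k t := rfl

theorem compactlySupported_mem_polynomiallyBounded (f : CompactlySupportedContinuousMap ℝ≥0 ℝ) :
    (f : ℝ≥0 → ℝ) ∈ polynomiallyBounded := by
  obtain ⟨C, hC⟩ := f.hasCompactSupport.exists_bound_of_continuous f.continuous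
  exact ⟨Polynomial.C C, fun t => by simpa using hC t⟩

/-- **Riesz–Haviland theorem** on the half-line: a sequence whose moment functional is nonnegative
on the polynomials that are nonnegative on the half-line is a Stieltjes moment sequence. -/
theorem IsPositiveOnHalfLine.isStieltjesMomentSeq {γ : ℕ → ℝ} (hγ : IsPositiveOnHalfLine γ) :
    IsStieltjesMomentSeq γ := by
  obtain ⟨g, hg, hpos⟩ := exists_positive_extension hγ
  have hmono : ∀ f₁ f₂ : polynomiallyBounded,
      (∀ t, (f₁ : ℝ≥0 → ℝ) t ≤ (f₂ : ℝ≥0 → ℝ) t) → g f₁ ≤ g f₂ := by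
    intro f₁ f₂ h
    have := hpos (f₂ - f₁) fun t => sub_nonneg.2 (h t)
    rw [map_sub] at this
    linarith
  let Λ₀ : CompactlySupportedContinuousMap ℝ≥0 ℝ →ₗ[ℝ] ℝ :=
    { toFun := fun f => g ⟨f, compactlySupported_mem_polynomiallyBounded f⟩
      map_add' := fun f₁ f₂ => by rw [← map_add]; rfl
      map_smul' := fun c f => by rw [RingHom.id_apply, ← map_smul]; rfl }
  let Λ := PositiveLinearMap.mk₀ Λ₀ fun f hf => hpos _ fun t =>
    CompactlySupportedContinuousMap.le_def.1 hf t
  let ρ := RealRMK.rieszMeasure Λ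
  let G : ℕ → ℕ → ℝ := fun n k =>
    g ⟨truncatedMonomial n k, compactlySupported_mem_polynomiallyBounded _⟩
  have hΛ : ∀ n k, ∫ t, truncatedMonomial n k t ∂ρ = G n k := fun n k =>
    RealRMK.integral_rieszMeasure Λ (truncatedMonomial n k)
  have hX : ∀ n, g (polynomialToFunction (Polynomial.X ^ n)) = γ n := fun n => by
    rw [hg, momentFunctional_X_pow]
  have hle : ∀ n k, G n k ≤ γ n := by
    intro n k
    rw [← hX]
    refine hmono _ _ fun t => ?_
    change (t : ℝ) ^ n * halfLineCutoff k t ≤ (Polynomial.X ^ n : Polynomial ℝ).eval (t : ℝ)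
    simpa using mul_le_of_le_one_right (pow_nonneg t.2 n) (halfLineCutoff_le_one k t)
  -- Where the cut-off differs from `1` one has `k ≤ t`, hence `k tⁿ ≤ tⁿ⁺¹`.
  have hge : ∀ n k : ℕ, (k : ℝ) * (γ n - G n k) ≤ γ (n + 1) := by
    intro n k
    rw [← hX, ← hX, ← map_sub, ← smul_eq_mul, ← map_smul]
    refine hmono _ _ fun t => ?_
    change (k : ℝ) * ((Polynomial.X ^ n : Polynomial ℝ).eval (t : ℝ)
      - (t : ℝ) ^ n * halfLineCutoff k t) ≤ (Polynomial.X ^ (n + 1) : Polynomial ℝ).eval (t : ℝ)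
    rw [Polynomial.eval_pow, Polynomial.eval_pow, Polynomial.eval_X]
    have ht : (0 : ℝ) ≤ t := t.2
    rcases le_total (t : ℝ) k with h | h
    · rw [halfLineCutoff_eq_one h, mul_one, sub_self, mul_zero]
      positivity
    · calc (k : ℝ) * ((t : ℝ) ^ n - (t : ℝ) ^ n * halfLineCutoff k t) ≤ k * (t : ℝ) ^ n := by
            gcongr
            exact sub_le_self _ (mul_nonneg (pow_nonneg ht n) (halfLineCutoff_nonneg k t))
        _ ≤ t * (t : ℝ) ^ n := by gcongr
        _ = (t : ℝ) ^ (n + 1) := (pow_succ' _ _).symm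
  have hlim : ∀ n, Filter.Tendsto (G n) Filter.atTop (nhds (γ n)) := by
    intro n
    have h0 : Filter.Tendsto (fun k : ℕ => γ n - γ (n + 1) / k) Filter.atTop (nhds (γ n)) := by
      simpa using tendsto_const_nhds.sub (tendsto_const_div_atTop_nhds_zero_nat (γ (n + 1)))
    refine tendsto_of_tendsto_of_tendsto_of_le_of_le' h0 tendsto_const_nhds ?_
      (Filter.Eventually.of_forall (hle n))
    filter_upwards [Filter.eventually_gt_atTop 0] with k hk
    have hk' : (0 : ℝ) < k := by exact_mod_cast hk
    have := hge n k
    rw [mul_comm, ← le_div_iff₀ hk'] at this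
    linarith
  have hint : ∀ n k, Integrable (fun t => truncatedMonomial n k t) ρ := fun n k =>
    (truncatedMonomial n k).continuous.integrable_of_hasCompactSupport
      (truncatedMonomial n k).hasCompactSupport
  have htrunc_mono : ∀ n (t : ℝ≥0), Monotone fun k => truncatedMonomial n k t := fun n t k l hkl =>
    mul_le_mul_of_nonneg_left (halfLineCutoff_mono t hkl) (pow_nonneg t.2 n)
  have htrunc_lim : ∀ n (t : ℝ≥0), Filter.Tendsto (fun k => truncatedMonomial n k t) Filter.atTop
      (nhds ((t : ℝ) ^ n)) := by
    intro n t
    obtain ⟨m, hm⟩ := exists_nat_ge (t : ℝ)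
    refine tendsto_const_nhds.congr' ?_
    filter_upwards [Filter.eventually_ge_atTop m] with k hk
    have : (m : ℝ) ≤ k := by exact_mod_cast hk
    rw [truncatedMonomial_apply, halfLineCutoff_eq_one (hm.trans this), mul_one]
  have hintpow : ∀ n, Integrable (fun t : ℝ≥0 => (t : ℝ) ^ n) ρ := by
    intro n
    have hlint : Filter.Tendsto (fun k => ∫⁻ t, ENNReal.ofReal (truncatedMonomial n k t) ∂ρ)
        Filter.atTop (nhds (∫⁻ t : ℝ≥0, ENNReal.ofReal ((t : ℝ) ^ n) ∂ρ)) :=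
      lintegral_tendsto_of_tendsto_of_monotone
        (fun k => (hint n k).aemeasurable.ennreal_ofReal)
        (Filter.Eventually.of_forall fun t k l hkl =>
          ENNReal.ofReal_le_ofReal (htrunc_mono n t hkl))
        (Filter.Eventually.of_forall fun t => ENNReal.tendsto_ofReal (htrunc_lim n t))
    have hbound : ∫⁻ t : ℝ≥0, ENNReal.ofReal ((t : ℝ) ^ n) ∂ρ ≤ ENNReal.ofReal (γ n) := by
      refine le_of_tendsto hlint (Filter.Eventually.of_forall fun k => ?_)
      rw [← ofReal_integral_eq_lintegral_ofReal (hint n k) (Filter.Eventually.of_forall fun t =>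
        mul_nonneg (pow_nonneg t.2 n) (halfLineCutoff_nonneg k t)), hΛ]
      exact ENNReal.ofReal_le_ofReal (hle n k)
    refine ⟨by fun_prop, ?_⟩
    exact (hasFiniteIntegral_iff_ofReal (f := fun t : ℝ≥0 => (t : ℝ) ^ n)
      (Filter.Eventually.of_forall fun t => pow_nonneg t.2 n)).2
        (hbound.trans_lt ENNReal.ofReal_lt_top)
  refine ⟨ρ, fun n => ⟨hintpow n, ?_⟩⟩
  have h1 := integral_tendsto_of_tendsto_of_monotone (hint n) (hintpow n)
    (Filter.Eventually.of_forall (htrunc_mono n)) (Filter.Eventually.of_forall (htrunc_lim n))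
  simp only [hΛ] at h1
  exact tendsto_nhds_unique (hlim n) h1

/-- The moment functional of a Stieltjes moment sequence is integration against a representing
measure, and hence is positive. -/
theorem IsStieltjesMomentSeq.isPositiveOnHalfLine {γ : ℕ → ℝ} (hγ : IsStieltjesMomentSeq γ) :
    IsPositiveOnHalfLine γ := by
  obtain ⟨ρ, hρ⟩ := hγ
  intro p hp
  have : momentFunctional γ p = ∫ s : ℝ≥0, p.eval (s : ℝ) ∂ρ := by
    rw [momentFunctional_apply]
    simp only [Polynomial.eval_eq_sum, Polynomial.sum]
    rw [integral_finsetSum _ fun n _ => (hρ n).1.const_mul _]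
    exact Finset.sum_congr rfl fun n _ => by rw [integral_const_mul, (hρ n).2]
  rw [this]
  exact integral_nonneg fun s => hp s s.2

/-- On the half-line `sʲ ≤ 1 + sⁿ` for `j ≤ n`. -/
theorem IsStieltjesMomentSeq.le_add {γ : ℕ → ℝ} (hγ : IsStieltjesMomentSeq γ) {j n : ℕ}
    (hjn : j ≤ n) : γ j ≤ γ 0 + γ n := by
  obtain ⟨ρ, hρ⟩ := hγ
  rw [(hρ j).2, (hρ 0).2, (hρ n).2, ← integral_add (hρ 0).1 (hρ n).1]
  refine integral_mono (hρ j).1 ((hρ 0).1.add (hρ n).1) fun s => ?_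
  have hs : (0 : ℝ) ≤ s := s.2
  change (s : ℝ) ^ j ≤ (s : ℝ) ^ 0 + (s : ℝ) ^ n
  rcases le_total (s : ℝ) 1 with h | h
  · have := pow_le_one₀ hs h (n := j)
    have := pow_nonneg hs n
    rw [pow_zero]
    linarith
  · have := pow_le_pow_right₀ h hjn
    rw [pow_zero]
    linarith

/-- A polynomial that is nonnegative on the half-line is a coefficientwise limit of polynomials
with rational coefficients and the same property, so positivity needs to be checked on countably
many polynomials only. -/
theorem isPositiveOnHalfLine_of_rat {γ : ℕ → ℝ}
    (hγ : ∀ q : Polynomial ℚ,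
      (∀ t : ℝ, 0 ≤ t → 0 ≤ (q.map (algebraMap ℚ ℝ)).eval t) →
        0 ≤ momentFunctional γ (q.map (algebraMap ℚ ℝ))) :
    IsPositiveOnHalfLine γ := by
  intro p hp
  set N := p.natDegree + 1
  have hsum : ∀ r : Polynomial ℝ,
      r = ∑ i ∈ Finset.range N, Polynomial.C (r.coeff i) * Polynomial.X ^ i →
      momentFunctional γ r = ∑ i ∈ Finset.range N, r.coeff i * γ i := by
    intro r hr
    conv_lhs => rw [hr]
    simp only [map_sum, ← Polynomial.smul_eq_C_mul, map_smul, momentFunctional_X_pow, smul_eq_mul]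
  -- Raising every coefficient a little to a rational number keeps the values at `t ≥ 0`
  -- nonnegative.
  have key : ∀ δ : ℝ, 0 < δ → 0 ≤ ∑ i ∈ Finset.range N, p.coeff i * γ i
      + δ * ∑ i ∈ Finset.range N, |γ i| := by
    intro δ hδ
    have hex : ∀ i, ∃ c : ℚ, p.coeff i < c ∧ (c : ℝ) < p.coeff i + δ := fun i =>
      exists_rat_btwn (by linarith)
    choose c hc1 hc2 using hex
    let q : Polynomial ℚ := ∑ i ∈ Finset.range N, Polynomial.C (c i) * Polynomial.X ^ i
    have hq : q.map (algebraMap ℚ ℝ)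
        = ∑ i ∈ Finset.range N, (c i : ℝ) • (Polynomial.X ^ i : Polynomial ℝ) := by
      simp [q, Polynomial.map_sum, Polynomial.smul_eq_C_mul]
    have h1 := hγ q (by
      intro t ht
      refine (hp t ht).trans ?_
      rw [hq, Polynomial.eval_finsetSum, Polynomial.eval_eq_sum_range]
      refine Finset.sum_le_sum fun i _ => ?_
      rw [Polynomial.eval_smul, Polynomial.eval_pow, Polynomial.eval_X, smul_eq_mul]
      exact mul_le_mul_of_nonneg_right (hc1 i).le (pow_nonneg ht i))
    rw [hq, map_sum] at h1
    refine h1.trans ?_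
    rw [Finset.mul_sum, ← Finset.sum_add_distrib]
    refine Finset.sum_le_sum fun i _ => ?_
    rw [map_smul, momentFunctional_X_pow, smul_eq_mul]
    have h2 : ((c i : ℝ) - p.coeff i) * γ i ≤ δ * |γ i| :=
      calc ((c i : ℝ) - p.coeff i) * γ i ≤ ((c i : ℝ) - p.coeff i) * |γ i| :=
            mul_le_mul_of_nonneg_left (le_abs_self _) (by linarith [hc1 i])
        _ ≤ δ * |γ i| := mul_le_mul_of_nonneg_right (by linarith [hc2 i]) (abs_nonneg _)
    linarith
  rw [hsum p p.as_sum_range_C_mul_X_pow]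
  have hcont : Filter.Tendsto (fun δ : ℝ => ∑ i ∈ Finset.range N, p.coeff i * γ i
      + δ * ∑ i ∈ Finset.range N, |γ i|) (nhdsWithin 0 (Set.Ioi 0))
      (nhds (∑ i ∈ Finset.range N, p.coeff i * γ i + 0 * ∑ i ∈ Finset.range N, |γ i|)) :=
    (Continuous.tendsto (by fun_prop) 0).mono_left nhdsWithin_le_nhds
  rw [zero_mul, add_zero] at hcont
  refine ge_of_tendsto hcont ?_
  filter_upwards [self_mem_nhdsWithin] with δ hδ using key δ hδ

/-! ### Integrals of moment functionals -/

section IntegralMoment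

variable {X : Type*} [MeasurableSpace X] {ν : Measure X} {g : ℕ → X → ℝ≥0∞}

theorem integrable_momentFunctional (hg : ∀ n, Measurable (g n))
    (hfin : ∀ n, ∫⁻ x, g n x ∂ν ≠ ∞) (p : Polynomial ℝ) :
    Integrable (fun x => momentFunctional (fun n => (g n x).toReal) p) ν := by
  simp only [momentFunctional_apply]
  exact integrable_finsetSum _ fun n _ =>
    (integrable_toReal_of_lintegral_ne_top (hg n).aemeasurable (hfin n)).const_mul _

theorem integral_momentFunctional (hg : ∀ n, Measurable (g n))
    (hfin : ∀ n, ∫⁻ x, g n x ∂ν ≠ ∞) (p : Polynomial ℝ) :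
    ∫ x, momentFunctional (fun n => (g n x).toReal) p ∂ν
      = momentFunctional (fun n => (∫⁻ x, g n x ∂ν).toReal) p := by
  simp only [momentFunctional_apply]
  rw [integral_finsetSum _ fun n _ =>
    (integrable_toReal_of_lintegral_ne_top (hg n).aemeasurable (hfin n)).const_mul _]
  refine Finset.sum_congr rfl fun n _ => ?_
  rw [integral_const_mul, integral_toReal (hg n).aemeasurable
    (ae_lt_top (hg n) (hfin n))]

/-- Mixtures of Stieltjes moment sequences are Stieltjes moment sequences. No measurable choice of
representing measures is needed, since positivity of the moment functional passes to integrals. -/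
theorem isStieltjesMomentSeq_lintegral (hg : ∀ n, Measurable (g n))
    (hfin : ∀ n, ∫⁻ x, g n x ∂ν ≠ ∞)
    (hS : ∀ᵐ x ∂ν, IsStieltjesMomentSeq fun n => (g n x).toReal) :
    IsStieltjesMomentSeq fun n => (∫⁻ x, g n x ∂ν).toReal := by
  refine IsPositiveOnHalfLine.isStieltjesMomentSeq fun p hp => ?_
  rw [← integral_momentFunctional hg hfin]
  refine integral_nonneg_of_ae ?_
  filter_upwards [hS] with x hx using hx.isPositiveOnHalfLine p hp

/-- If the integrals of `g n` over every measurable set form a Stieltjes moment sequence, then the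
pointwise moment functional is nonnegative almost everywhere at each `p` that is nonnegative on the
half-line. The exceptional null set may depend on `p`. -/
theorem ae_momentFunctional_nonneg (hg : ∀ n, Measurable (g n))
    (hfin : ∀ n, ∫⁻ x, g n x ∂ν ≠ ∞)
    (hS : ∀ s, MeasurableSet s → IsStieltjesMomentSeq fun n => (∫⁻ x in s, g n x ∂ν).toReal)
    {p : Polynomial ℝ} (hp : ∀ t : ℝ, 0 ≤ t → 0 ≤ p.eval t) :
    ∀ᵐ x ∂ν, 0 ≤ momentFunctional (fun n => (g n x).toReal) p := by
  refine ae_nonneg_of_forall_setIntegral_nonneg (integrable_momentFunctional hg hfin p)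
    fun s hs _ => ?_
  rw [integral_momentFunctional hg fun n =>
    ((setLIntegral_le_lintegral s _).trans_lt (hfin n).lt_top).ne]
  exact (hS s hs).isPositiveOnHalfLine p hp

/-- A countable family of almost everywhere finite functions is simultaneously integrable on the
members of an exhausting sequence of sets. -/
theorem exists_exhaustion [SigmaFinite ν] (hg : ∀ n, Measurable (g n))
    (hfin : ∀ n, ∀ᵐ x ∂ν, g n x < ∞) :
    ∃ E : ℕ → Set X, (∀ m, MeasurableSet (E m)) ∧ (∀ m n, ∫⁻ x in E m, g n x ∂ν < ∞) ∧
      ∀ᵐ x ∂ν, ∀ᶠ m in Filter.atTop, x ∈ E m := by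
  obtain ⟨δ, hδ, hδsum⟩ := ENNReal.exists_pos_sum_of_countable one_ne_zero ℕ
  have hex : ∀ n, ∃ k : ℕ, ν.toFinite {x | (k : ℝ≥0∞) < g n x} < δ n := by
    intro n
    have hlim := tendsto_measure_iInter_atTop (μ := ν.toFinite)
      (s := fun k : ℕ => {x | (k : ℝ≥0∞) < g n x})
      (fun k => (measurableSet_lt measurable_const (hg n)).nullMeasurableSet)
      (fun k l hkl x (hx : (l : ℝ≥0∞) < g n x) =>
        show (k : ℝ≥0∞) < g n x from lt_of_le_of_lt (by exact_mod_cast hkl) hx)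
      ⟨0, measure_ne_top _ _⟩
    have hzero : ν.toFinite (⋂ k : ℕ, {x | (k : ℝ≥0∞) < g n x}) = 0 := by
      have h : ∀ᵐ x ∂ν.toFinite, g n x < ∞ := by
        rw [ae_toFinite]
        exact hfin n
      refine measure_mono_null (fun x hx => ?_) (ae_iff.1 h)
      intro hlt
      obtain ⟨k, hk⟩ := ENNReal.exists_nat_gt hlt.ne
      exact lt_asymm hk (Set.mem_iInter.1 hx k)
    rw [hzero] at hlim
    exact (hlim.eventually (gt_mem_nhds (by exact_mod_cast hδ n))).exists
  choose k hk using hex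
  refine ⟨fun m => spanningSets ν m ∩ ⋂ n, {x | g n x ≤ (k n : ℝ≥0∞) + m}, fun m => ?_,
    fun m n => ?_, ?_⟩
  · exact (measurableSet_spanningSets ν m).inter (MeasurableSet.iInter fun n =>
      measurableSet_le (hg n) measurable_const)
  · calc ∫⁻ x in spanningSets ν m ∩ ⋂ n, {x | g n x ≤ (k n : ℝ≥0∞) + m}, g n x ∂ν
        ≤ ∫⁻ x in spanningSets ν m ∩ ⋂ n, {x | g n x ≤ (k n : ℝ≥0∞) + m}, (k n : ℝ≥0∞) + m ∂ν :=
          setLIntegral_mono measurable_const fun x hx => Set.mem_iInter.1 hx.2 n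
      _ = ((k n : ℝ≥0∞) + m) * ν (spanningSets ν m ∩ ⋂ n, {x | g n x ≤ (k n : ℝ≥0∞) + m}) :=
          setLIntegral_const _ _
      _ < ∞ := ENNReal.mul_lt_top (by finiteness)
          ((measure_mono Set.inter_subset_left).trans_lt (measure_spanningSets_lt_top ν m))
  · -- By Borel–Cantelli, almost every point violates only finitely many of the bounds `g n ≤ k n`.
    have hBC : ∀ᵐ x ∂ν, {n | (k n : ℝ≥0∞) < g n x}.Finite := by
      rw [← ae_toFinite]
      refine ae_finite_setOfPred_mem (s := fun n => {x | (k n : ℝ≥0∞) < g n x})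
        (((ENNReal.tsum_le_tsum fun n => (hk n).le).trans_lt hδsum).trans ENNReal.one_lt_top).ne
    filter_upwards [hBC, ae_all_iff.2 hfin] with x hx hxfin
    have hbdd : ∀ᶠ m : ℕ in Filter.atTop, ∀ n ∈ {n | (k n : ℝ≥0∞) < g n x}, g n x ≤ m := by
      refine (Filter.eventually_all_finite hx).2 fun n _ => ?_
      obtain ⟨l, hl⟩ := ENNReal.exists_nat_gt (hxfin n).ne
      filter_upwards [Filter.eventually_ge_atTop l] with m hm
      exact hl.le.trans (by exact_mod_cast hm)
    filter_upwards [hbdd, Filter.eventually_ge_atTop (spanningSetsIndex ν x)] with m hm hm'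
    refine ⟨mem_spanningSets_of_index_le ν x hm', Set.mem_iInter.2 fun n => ?_⟩
    rcases lt_or_ge (k n : ℝ≥0∞) (g n x) with h | h
    · exact (hm n h).trans le_add_self
    · exact h.trans le_self_add

end IntegralMoment

/-! ### Powers of composition operators -/

section CompositionPowers

variable {X : Type*} [MeasurableSpace X] {μ : Measure X}

/-- The weighted energy `∫ |f|² h_{φⁿ} dμ`; by change of variables it is `‖f ∘ φⁿ‖²`. -/
noncomputable def iterEnergy (μ : Measure X) (φ : X → X) (n : ℕ) (f : X → ℂ) : ℝ≥0∞ :=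
  ∫⁻ x, ‖f x‖ₑ ^ 2 * rnIter μ φ n x ∂μ

theorem iterEnergy_congr {φ : X → X} (n : ℕ) {f g : X → ℂ} (h : f =ᵐ[μ] g) :
    iterEnergy μ φ n f = iterEnergy μ φ n g := by
  refine lintegral_congr_ae ?_
  filter_upwards [h] with x hx
  rw [hx]

theorem iterEnergy_indicator {φ : X → X} (n : ℕ) (f : X → ℂ) {s : Set X} (hs : MeasurableSet s) :
    iterEnergy μ φ n (s.indicator f) = ∫⁻ x in s, ‖f x‖ₑ ^ 2 * rnIter μ φ n x ∂μ := by
  rw [iterEnergy, ← lintegral_indicator hs]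
  refine lintegral_congr fun x => ?_
  by_cases hx : x ∈ s <;> simp [hx]

/-- Change of variables along `φⁿ`. -/
theorem lintegral_comp_iterate [SigmaFinite μ] {φ : X → X}
    (hφ : Measure.QuasiMeasurePreserving φ μ μ) (n : ℕ) {G : X → ℝ≥0∞} (hG : Measurable G) :
    ∫⁻ x, G (φ^[n] x) ∂μ = ∫⁻ x, G x * rnIter μ φ n x ∂μ := by
  rw [← lintegral_map hG (hφ.iterate n).measurable,
    ← Measure.withDensity_rnDeriv_eq _ _ (hφ.iterate n).absolutelyContinuous,
    lintegral_withDensity_eq_lintegral_mul _ (Measure.measurable_rnDeriv _ _) hG]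
  exact lintegral_congr fun x => mul_comm _ _

theorem eLpNorm_comp_iterate_sq [SigmaFinite μ] {φ : X → X}
    (hφ : Measure.QuasiMeasurePreserving φ μ μ) (n : ℕ) (f : Lp ℂ 2 μ) :
    eLpNorm (f ∘ φ^[n]) 2 μ ^ 2 = iterEnergy μ φ n f := by
  have h := eLpNorm_nnreal_pow_eq_lintegral (μ := μ) (f := f ∘ φ^[n]) (p := 2) two_ne_zero
  simp only [NNReal.coe_ofNat, ENNReal.rpow_ofNat, ENNReal.coe_ofNat] at h
  rw [h, iterEnergy,
    ← lintegral_comp_iterate hφ n ((Lp.stronglyMeasurable f).enorm.pow_const 2)]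
  rfl

theorem memLp_comp_iterate_iff [SigmaFinite μ] {φ : X → X}
    (hφ : Measure.QuasiMeasurePreserving φ μ μ) (n : ℕ) (f : Lp ℂ 2 μ) :
    MemLp (f ∘ φ^[n]) 2 μ ↔ iterEnergy μ φ n f < ∞ := by
  rw [← eLpNorm_comp_iterate_sq hφ, ENNReal.pow_lt_top_iff]
  refine ⟨fun h => Or.inl h.2, fun h => ⟨?_, h.resolve_right two_ne_zero⟩⟩
  exact ((Lp.stronglyMeasurable f).comp_measurable (hφ.iterate n).measurable).aestronglyMeasurable

theorem iterEnergy_zero_lt_top [SigmaFinite μ] {φ : X → X}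
    (hφ : Measure.QuasiMeasurePreserving φ μ μ) (f : Lp ℂ 2 μ) : iterEnergy μ φ 0 f < ∞ :=
  (memLp_comp_iterate_iff hφ 0 f).1 (Lp.memLp f)

theorem opPow_compositionOp_apply {φ : X → X}
    (hφ : Measure.QuasiMeasurePreserving φ μ μ) (n : ℕ) (f : (opPow (compositionOp hφ) n).domain) :
    opPow (compositionOp hφ) n f =ᵐ[μ] (f : Lp ℂ 2 μ) ∘ φ^[n] := by
  induction n with
  | zero => exact Filter.EventuallyEq.rfl
  | succ n ih =>
    have h := hφ.ae_eq_comp (ih ⟨f.1, f.2.fst⟩)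
    exact (MemLp.coeFn_toLp (f.2.snd : MemLp _ 2 μ)).trans h

/-- On its maximal domain `C_φⁿ` needs all the intermediate energies to be finite; this is what may
make `D(C_φⁿ)` smaller than `D(C_{φⁿ})`. -/
theorem mem_domain_opPow_iff [SigmaFinite μ] {φ : X → X}
    (hφ : Measure.QuasiMeasurePreserving φ μ μ) (n : ℕ) (f : Lp ℂ 2 μ) :
    f ∈ (opPow (compositionOp hφ) n).domain ↔ ∀ j ≤ n, iterEnergy μ φ j f < ∞ := by
  induction n with
  | zero =>
    refine ⟨fun _ j hj => ?_, fun _ => Submodule.mem_top⟩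
    rw [Nat.le_zero.1 hj]
    exact iterEnergy_zero_lt_top hφ f
  | succ n ih =>
    have hstep : f ∈ (opPow (compositionOp hφ) (n + 1)).domain ↔
        f ∈ (opPow (compositionOp hφ) n).domain ∧ iterEnergy μ φ (n + 1) f < ∞ := by
      rw [← memLp_comp_iterate_iff hφ]
      have hcomp := fun hf : f ∈ (opPow (compositionOp hφ) n).domain =>
        memLp_congr_ae (p := 2)
          (hφ.ae_eq_comp (opPow_compositionOp_apply hφ n ⟨f, hf⟩))
      exact ⟨fun ⟨hf, h⟩ => ⟨hf, (hcomp hf).1 h⟩, fun ⟨hf, h⟩ => ⟨hf, (hcomp hf).2 h⟩⟩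
    rw [hstep, ih]
    constructor
    · rintro ⟨h, h'⟩ j hj
      rcases Nat.le_succ_iff.1 hj with hj | rfl
      exacts [h j hj, h']
    · exact fun h => ⟨fun j hj => h j (hj.trans n.le_succ), h _ le_rfl⟩

theorem mem_smoothVectors_iff [SigmaFinite μ] {φ : X → X}
    (hφ : Measure.QuasiMeasurePreserving φ μ μ) (f : Lp ℂ 2 μ) :
    f ∈ smoothVectors (compositionOp hφ) ↔ ∀ n, iterEnergy μ φ n f < ∞ := by
  rw [smoothVectors, Submodule.mem_iInf]
  simp only [mem_domain_opPow_iff]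
  exact ⟨fun h n => h n n le_rfl, fun h n j _ => h j⟩

theorem norm_opPow_sq [SigmaFinite μ] {φ : X → X}
    (hφ : Measure.QuasiMeasurePreserving φ μ μ) (n : ℕ) (f : (opPow (compositionOp hφ) n).domain) :
    ‖opPow (compositionOp hφ) n f‖ ^ 2 = (iterEnergy μ φ n (f : Lp ℂ 2 μ)).toReal := by
  rw [← eLpNorm_comp_iterate_sq hφ, ENNReal.toReal_pow, Lp.norm_def,
    eLpNorm_congr_ae (opPow_compositionOp_apply hφ n f)]

theorem norm_sq_eq_iterEnergy_zero [SigmaFinite μ] {φ : X → X}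
    (hφ : Measure.QuasiMeasurePreserving φ μ μ) (f : Lp ℂ 2 μ) :
    ‖f‖ ^ 2 = (iterEnergy μ φ 0 f).toReal := by
  rw [← eLpNorm_comp_iterate_sq hφ, ENNReal.toReal_pow, Lp.norm_def]
  rfl

/-- If `D(C_φᵏ)` is dense, then `h_{φᵏ}` is finite almost everywhere: all members of the domain
vanish where `h_{φᵏ} = ∞`, so indicators of subsets of that set are orthogonal to the domain. -/
theorem ae_rnIter_lt_top_of_dense [SigmaFinite μ] {φ : X → X}
    (hφ : Measure.QuasiMeasurePreserving φ μ μ) {k : ℕ}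
    (hd : Dense ((opPow (compositionOp hφ) k).domain : Set (Lp ℂ 2 μ))) :
    ∀ᵐ x ∂μ, rnIter μ φ k x < ∞ := by
  have hS : MeasurableSet {x | rnIter μ φ k x = ∞} :=
    measurable_rnIter μ φ k (measurableSet_singleton ∞)
  have hT : ∀ m, μ ({x | rnIter μ φ k x = ∞} ∩ spanningSets μ m) = 0 := by
    intro m
    have hTm := hS.inter (measurableSet_spanningSets μ m)
    have hTfin : μ ({x | rnIter μ φ k x = ∞} ∩ spanningSets μ m) ≠ ∞ :=
      ((measure_mono Set.inter_subset_right).trans_lt (measure_spanningSets_lt_top μ m)).ne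
    have hzero : indicatorConstLp 2 hTm hTfin (1 : ℂ) = 0 := by
      refine hd.eq_zero_of_inner_left ℂ fun f hf => ?_
      rw [L2.inner_indicatorConstLp_one]
      have hfE := (mem_domain_opPow_iff hφ k f).1 hf k le_rfl
      have hmeas : Measurable fun x => ‖f x‖ₑ ^ 2 * rnIter μ φ k x :=
        ((Lp.stronglyMeasurable f).enorm.pow_const 2).mul (measurable_rnIter μ φ k)
      refine setIntegral_eq_zero_of_ae_eq_zero ?_
      filter_upwards [ae_lt_top hmeas hfE.ne] with x hx hxT
      rw [show rnIter μ φ k x = ∞ from hxT.1] at hx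
      by_contra hne
      rw [ENNReal.mul_top (by simpa using hne)] at hx
      exact lt_irrefl _ hx
    have hnorm := congrArg norm hzero
    rw [norm_indicatorConstLp two_ne_zero ENNReal.ofNat_ne_top, norm_zero,
      norm_one, one_mul, Real.rpow_eq_zero_iff_of_nonneg measureReal_nonneg] at hnorm
    exact (measureReal_eq_zero_iff hTfin).1 hnorm.1
  rw [ae_iff]
  have : {x | ¬rnIter μ φ k x < ∞} = ⋃ m, {x | rnIter μ φ k x = ∞} ∩ spanningSets μ m := by
    rw [← Set.inter_iUnion, iUnion_spanningSets, Set.inter_univ]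
    ext x
    simp
  rw [this]
  exact measure_iUnion_null hT

/-- When all `h_{φʲ}` are finite almost everywhere, truncation approximates a vector of finite
`n`-th energy by `C^∞`-vectors, in the norm of `L²(μ)` and in the `n`-th energy. -/
theorem exists_smoothVector_approx [SigmaFinite μ] {φ : X → X}
    (hφ : Measure.QuasiMeasurePreserving φ μ μ) (hfin : ∀ n, ∀ᵐ x ∂μ, rnIter μ φ n x < ∞)
    (n : ℕ) {f : Lp ℂ 2 μ} (hf : iterEnergy μ φ n f < ∞) {ε : ℝ≥0∞} (hε : 0 < ε) :
    ∃ g ∈ smoothVectors (compositionOp hφ),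
      iterEnergy μ φ 0 (f - g : Lp ℂ 2 μ) < ε ∧ iterEnergy μ φ n (f - g : Lp ℂ 2 μ) < ε := by
  obtain ⟨E, hEm, hEfin, hEev⟩ := exists_exhaustion (fun n => measurable_rnIter μ φ n) hfin
  have hfmeas : Measurable fun x => ‖f x‖ₑ := (Lp.stronglyMeasurable f).enorm
  let F : ℕ → Set X := fun m => E m ∩ {x | ‖f x‖ₑ ≤ m}
  have hF : ∀ m, MeasurableSet (F m) := fun m =>
    (hEm m).inter (measurableSet_le hfmeas measurable_const)
  let g : ℕ → Lp ℂ 2 μ := fun m => ((Lp.memLp f).indicator (hF m)).toLp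
  have hg : ∀ m, g m =ᵐ[μ] (F m).indicator f := fun m => MemLp.coeFn_toLp _
  have hgs : ∀ m, g m ∈ smoothVectors (compositionOp hφ) := by
    intro m
    rw [mem_smoothVectors_iff]
    intro j
    rw [iterEnergy_congr j (hg m), iterEnergy_indicator j _ (hF m)]
    calc ∫⁻ x in F m, ‖f x‖ₑ ^ 2 * rnIter μ φ j x ∂μ
        ≤ ∫⁻ x in F m, (m : ℝ≥0∞) ^ 2 * rnIter μ φ j x ∂μ := by
          refine setLIntegral_mono ((measurable_rnIter μ φ j).const_mul _) fun x hx => ?_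
          gcongr
          exact hx.2
      _ ≤ ∫⁻ x in E m, (m : ℝ≥0∞) ^ 2 * rnIter μ φ j x ∂μ :=
          lintegral_mono_set Set.inter_subset_left
      _ = (m : ℝ≥0∞) ^ 2 * ∫⁻ x in E m, rnIter μ φ j x ∂μ :=
          lintegral_const_mul _ (measurable_rnIter μ φ j)
      _ < ∞ := ENNReal.mul_lt_top (by finiteness) (hEfin m j)
  have hsub : ∀ m, (f - g m : Lp ℂ 2 μ) =ᵐ[μ] (F m)ᶜ.indicator f := by
    intro m
    filter_upwards [Lp.coeFn_sub f (g m), hg m] with x hx hx'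
    rw [hx, Pi.sub_apply, hx']
    by_cases h : x ∈ F m <;> simp [h]
  have hFev : ∀ᵐ x ∂μ, ∀ᶠ m in Filter.atTop, x ∈ F m := by
    filter_upwards [hEev] with x hx
    obtain ⟨l, hl⟩ := ENNReal.exists_nat_gt (enorm_ne_top (x := f x))
    filter_upwards [hx, Filter.eventually_ge_atTop l] with m hm hm'
    exact ⟨hm, hl.le.trans (by exact_mod_cast hm')⟩
  have hlim : ∀ j, iterEnergy μ φ j f < ∞ →
      Filter.Tendsto (fun m => iterEnergy μ φ j (f - g m : Lp ℂ 2 μ)) Filter.atTop (nhds 0) := by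
    intro j hj
    have hmeas : Measurable fun x => ‖f x‖ₑ ^ 2 * rnIter μ φ j x :=
      (hfmeas.pow_const 2).mul (measurable_rnIter μ φ j)
    have h := tendsto_lintegral_of_dominated_convergence (μ := μ)
      (F := fun m => (F m)ᶜ.indicator fun x => ‖f x‖ₑ ^ 2 * rnIter μ φ j x) (f := fun _ => 0)
      (fun x => ‖f x‖ₑ ^ 2 * rnIter μ φ j x) (fun m => hmeas.indicator (hF m).compl)
      (fun m => Filter.Eventually.of_forall fun x => Set.indicator_le_self _ _ x) hj.ne
      (by
        filter_upwards [hFev] with x hx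
        refine tendsto_const_nhds.congr' ?_
        filter_upwards [hx] with m hm
        simp [hm])
    rw [lintegral_zero] at h
    refine h.congr fun m => ?_
    rw [iterEnergy_congr j (hsub m), iterEnergy_indicator j _ (hF m).compl,
      lintegral_indicator (hF m).compl]
  obtain ⟨m, h0, hn⟩ :=
    (((hlim 0 (iterEnergy_zero_lt_top hφ f)).eventually (gt_mem_nhds hε)).and
      ((hlim n hf).eventually (gt_mem_nhds hε))).exists
  exact ⟨g m, hgs m, h0, hn⟩

theorem isCoreFor_smoothVectors [SigmaFinite μ] {φ : X → X}
    (hφ : Measure.QuasiMeasurePreserving φ μ μ) (hfin : ∀ n, ∀ᵐ x ∂μ, rnIter μ φ n x < ∞)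
    (n : ℕ) : IsCoreFor (smoothVectors (compositionOp hφ)) (opPow (compositionOp hφ) n) := by
  refine ⟨iInf_le _ n, fun f ε hε => ?_⟩
  have hε' : 0 < ε ^ 2 / 2 := by positivity
  obtain ⟨g, hg, h0, hn⟩ := exists_smoothVector_approx hφ hfin n
    ((mem_domain_opPow_iff hφ n f).1 f.2 n le_rfl) (ENNReal.ofReal_pos.2 hε')
  have hgn : g ∈ (opPow (compositionOp hφ) n).domain :=
    (Submodule.mem_iInf _).1 hg n
  refine ⟨⟨g, hgn⟩, hg, ?_⟩
  rw [Real.sqrt_lt' hε, norm_opPow_sq hφ, norm_sq_eq_iterEnergy_zero hφ]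
  have h0' := (ENNReal.toReal_lt_of_lt_ofReal h0)
  have hn' := (ENNReal.toReal_lt_of_lt_ofReal hn)
  change (iterEnergy μ φ 0 ((f : Lp ℂ 2 μ) - g : Lp ℂ 2 μ)).toReal
    + (iterEnergy μ φ n ((f : Lp ℂ 2 μ) - g : Lp ℂ 2 μ)).toReal < ε ^ 2
  linarith

theorem dense_smoothVectors [SigmaFinite μ] {φ : X → X}
    (hφ : Measure.QuasiMeasurePreserving φ μ μ) (hfin : ∀ n, ∀ᵐ x ∂μ, rnIter μ φ n x < ∞) :
    Dense (smoothVectors (compositionOp hφ) : Set (Lp ℂ 2 μ)) := by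
  rw [Metric.dense_iff]
  intro f ε hε
  obtain ⟨g, hg, h⟩ := (isCoreFor_smoothVectors hφ hfin 0).2 ⟨f, Submodule.mem_top⟩ ε hε
  refine ⟨g, ?_, hg⟩
  rw [Metric.mem_ball, dist_comm, dist_eq_norm]
  refine lt_of_le_of_lt ?_ h
  exact Real.le_sqrt_of_sq_le (le_add_of_nonneg_right (sq_nonneg _))

/-- `|f|² h_{φʲ} ≤ |f|² (h_{φ⁰} + h_{φⁿ})` for `j ≤ n`, so finiteness of the `n`-th energy alone
puts `f` into `D(C_φⁿ)`. -/
theorem opPow_eq_compositionOp_iterate [SigmaFinite μ] {φ : X → X}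
    (hφ : Measure.QuasiMeasurePreserving φ μ μ)
    (hS : ∀ᵐ x ∂μ, IsStieltjesMomentSeqENN fun n => rnIter μ φ n x) (n : ℕ) :
    opPow (compositionOp hφ) n = compositionOp (hφ.iterate n) := by
  refine LinearPMap.ext ?_ fun f hf hf' => ?_
  · ext f
    refine ((mem_domain_opPow_iff hφ n f).trans ⟨fun h => h n le_rfl, fun h j hj => ?_⟩).trans
      (memLp_comp_iterate_iff hφ n f).symm
    calc iterEnergy μ φ j f
        ≤ ∫⁻ x, (‖f x‖ₑ ^ 2 * rnIter μ φ 0 x + ‖f x‖ₑ ^ 2 * rnIter μ φ n x) ∂μ := by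
          refine lintegral_mono_ae ?_
          filter_upwards [hS] with x hx
          rw [← mul_add]
          gcongr
          rw [← ENNReal.toReal_le_toReal (hx.1 j) (ENNReal.add_ne_top.2 ⟨hx.1 0, hx.1 n⟩),
            ENNReal.toReal_add (hx.1 0) (hx.1 n)]
          exact hx.2.le_add hj
      _ = iterEnergy μ φ 0 f + iterEnergy μ φ n f :=
          lintegral_add_left (((Lp.stronglyMeasurable f).enorm.pow_const 2).mul
            (measurable_rnIter μ φ 0)) _
      _ < ∞ := ENNReal.add_lt_top.2 ⟨iterEnergy_zero_lt_top hφ f, h⟩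
  · exact Lp.ext ((opPow_compositionOp_apply hφ n ⟨f, hf⟩).trans
      (MemLp.coeFn_toLp (hf' : MemLp _ 2 μ)).symm)

end CompositionPowers

/-! ### The equivalent conditions -/

section Equivalence

variable {X : Type*} [MeasurableSpace X] {μ : Measure X} {φ : X → X}

theorem ae_rnIter_zero_lt_top (μ : Measure X) [SigmaFinite μ] (φ : X → X) :
    ∀ᵐ x ∂μ, rnIter μ φ 0 x < ∞ := by
  rw [rnIter, Function.iterate_zero, Measure.map_id]
  exact Measure.rnDeriv_lt_top μ μ

/-- Positivity almost everywhere for each polynomial gives positivity for all polynomials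
simultaneously, since rational coefficients suffice. -/
theorem ae_isStieltjesMomentSeqENN_of_forall_polynomial
    (hfin : ∀ n, ∀ᵐ x ∂μ, rnIter μ φ n x < ∞)
    (hpos : ∀ p : Polynomial ℝ, (∀ t : ℝ, 0 ≤ t → 0 ≤ p.eval t) →
      ∀ᵐ x ∂μ, 0 ≤ momentFunctional (fun n => (rnIter μ φ n x).toReal) p) :
    ∀ᵐ x ∂μ, IsStieltjesMomentSeqENN fun n => rnIter μ φ n x := by
  have : Countable (Polynomial ℚ) := by
    rw [← Cardinal.mk_le_aleph0_iff]
    exact Polynomial.cardinalMk_le_max.trans (by simp)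
  have hall : ∀ᵐ x ∂μ, ∀ q : Polynomial ℚ,
      (∀ t : ℝ, 0 ≤ t → 0 ≤ (q.map (algebraMap ℚ ℝ)).eval t) →
        0 ≤ momentFunctional (fun n => (rnIter μ φ n x).toReal) (q.map (algebraMap ℚ ℝ)) := by
    rw [ae_all_iff]
    intro q
    by_cases hq : ∀ t : ℝ, 0 ≤ t → 0 ≤ (q.map (algebraMap ℚ ℝ)).eval t
    · filter_upwards [hpos _ hq] with x hx _ using hx
    · exact Filter.Eventually.of_forall fun x h => absurd h hq
  filter_upwards [hall, ae_all_iff.2 hfin] with x hx hxfin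
  exact ⟨fun n => (hxfin n).ne, (isPositiveOnHalfLine_of_rat hx).isStieltjesMomentSeq⟩

theorem generatesStieltjes_of_ae [SigmaFinite μ]
    (hφ : Measure.QuasiMeasurePreserving φ μ μ)
    (hS : ∀ᵐ x ∂μ, IsStieltjesMomentSeqENN fun n => rnIter μ φ n x) :
    GeneratesStieltjes (compositionOp hφ) := by
  refine ⟨dense_smoothVectors hφ fun n => ?_, fun f => ?_⟩
  · filter_upwards [hS] with x hx using (hx.1 n).lt_top
  simp only [norm_opPow_sq hφ]
  refine isStieltjesMomentSeq_lintegral (fun n =>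
    ((Lp.stronglyMeasurable (f : Lp ℂ 2 μ)).enorm.pow_const 2).mul (measurable_rnIter μ φ n))
    (fun n => ((mem_smoothVectors_iff hφ f).1 f.2 n).ne) ?_
  filter_upwards [hS] with x hx
  refine IsPositiveOnHalfLine.isStieltjesMomentSeq fun p hp => ?_
  have h := hx.2.isPositiveOnHalfLine p hp
  rw [momentFunctional_apply] at h ⊢
  refine (mul_nonneg (ENNReal.toReal_nonneg (a := ‖(f : Lp ℂ 2 μ) x‖ₑ ^ 2)) h).trans_eq ?_
  rw [Finset.mul_sum]
  refine Finset.sum_congr rfl fun n _ => ?_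
  simp only [ENNReal.toReal_mul, toPowDomain]
  ring

/-- Indicators of sets `Δ` with all `μ(φ⁻ᵏ(Δ))` finite are `C^∞`-vectors, and
`‖C_φⁿ 1_Δ‖² = μ(φ⁻ⁿ(Δ))`. -/
theorem GeneratesStieltjes.isStieltjesMomentSeqENN_preimage [SigmaFinite μ]
    {hφ : Measure.QuasiMeasurePreserving φ μ μ} (h : GeneratesStieltjes (compositionOp hφ))
    {Δ : Set X} (hΔ : MeasurableSet Δ) (hfin : ∀ k : ℕ, μ (φ^[k] ⁻¹' Δ) < ∞) :
    IsStieltjesMomentSeqENN fun n => μ (φ^[n] ⁻¹' Δ) := by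
  refine ⟨fun n => (hfin n).ne, ?_⟩
  have hΔfin : μ Δ ≠ ∞ := (hfin 0).ne
  have hE : ∀ n, iterEnergy μ φ n (indicatorConstLp 2 hΔ hΔfin (1 : ℂ))
      = μ (φ^[n] ⁻¹' Δ) := by
    intro n
    rw [iterEnergy_congr n indicatorConstLp_coeFn, iterEnergy_indicator n _ hΔ,
      ← lintegral_rnIter hφ n hΔ]
    simp
  have hs : indicatorConstLp 2 hΔ hΔfin (1 : ℂ) ∈ smoothVectors (compositionOp hφ) := by
    rw [mem_smoothVectors_iff]
    intro n
    rw [hE]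
    exact hfin n
  have := h.2 ⟨_, hs⟩
  simp only [norm_opPow_sq hφ] at this
  simp only [toPowDomain, hE] at this
  exact this

theorem ae_isStieltjesMomentSeqENN_of_preimage [SigmaFinite μ]
    (hφ : Measure.QuasiMeasurePreserving φ μ μ)
    (hfin : ∀ n, ∀ᵐ x ∂μ, rnIter μ φ n x < ∞)
    (hS : ∀ Δ : Set X, MeasurableSet Δ → (∀ k : ℕ, μ (φ^[k] ⁻¹' Δ) < ∞) →
      IsStieltjesMomentSeqENN fun n => μ (φ^[n] ⁻¹' Δ)) :
    ∀ᵐ x ∂μ, IsStieltjesMomentSeqENN fun n => rnIter μ φ n x := by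
  refine ae_isStieltjesMomentSeqENN_of_forall_polynomial hfin fun p hp => ?_
  obtain ⟨E, hEm, hEfin, hEev⟩ := exists_exhaustion (fun n => measurable_rnIter μ φ n) hfin
  have hE : ∀ m, ∀ᵐ x ∂μ, x ∈ E m →
      0 ≤ momentFunctional (fun n => (rnIter μ φ n x).toReal) p := by
    intro m
    rw [← ae_restrict_iff' (hEm m)]
    refine ae_momentFunctional_nonneg (fun n => measurable_rnIter μ φ n)
      (fun n => (hEfin m n).ne) (fun s hs => ?_) hp
    have hint : ∀ n, ∫⁻ x in s, rnIter μ φ n x ∂μ.restrict (E m) = μ (φ^[n] ⁻¹' (s ∩ E m)) := by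
      intro n
      rw [Measure.restrict_restrict hs, lintegral_rnIter hφ n (hs.inter (hEm m))]
    simp only [hint]
    refine (hS _ (hs.inter (hEm m)) fun k => ?_).2
    rw [← hint]
    exact (setLIntegral_le_lintegral s _).trans_lt (hEfin m k)
  filter_upwards [hEev, ae_all_iff.2 hE] with x hx hx'
  obtain ⟨m, hm⟩ := hx.exists
  exact hx' m hm

theorem momentMap_apply (μ : Measure X) (φ : X → X) (p : Polynomial ℂ) (x : X) :
    (momentMap μ φ p : X → ℂ) x
      = ∑ n ∈ p.support, p.coeff n * ((rnIter μ φ n x).toReal : ℂ) := by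
  rw [momentMap, Module.Basis.constr_apply, Finsupp.sum, Submodule.coe_sum, Finset.sum_apply]
  rfl

theorem momentMap_map_ofReal (μ : Measure X) (φ : X → X) (p : Polynomial ℝ) (x : X) :
    (momentMap μ φ (p.map Complex.ofRealHom) : X → ℂ) x
      = (momentFunctional (fun n => (rnIter μ φ n x).toReal) p : ℝ) := by
  rw [momentMap_apply, momentFunctional_apply,
    Polynomial.support_map_of_injective _ Complex.ofReal_injective, Complex.ofReal_sum]
  simp

/-- At a point where `h_{φⁿ}(x)` is a Stieltjes moment sequence, `L(p)(x)` is the integral of `p`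
against a representing measure. -/
theorem momentMap_nonneg {x : X} (hx : IsStieltjesMomentSeqENN fun n => rnIter μ φ n x)
    {p : Polynomial ℂ} (hp : ∀ t : ℝ, 0 ≤ t → 0 ≤ p.eval (t : ℂ)) :
    0 ≤ (momentMap μ φ p : X → ℂ) x := by
  obtain ⟨ρ, hρ⟩ := hx.2
  have hint : ∀ n, Integrable (fun s : ℝ≥0 => p.coeff n * ((s : ℝ) : ℂ) ^ n) ρ := fun n => by
    have := ((hρ n).1.ofReal (𝕜 := ℂ)).const_mul (p.coeff n)
    simpa using this
  have : (momentMap μ φ p : X → ℂ) x = ∫ s : ℝ≥0, p.eval ((s : ℝ) : ℂ) ∂ρ := by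
    rw [momentMap_apply]
    simp only [Polynomial.eval_eq_sum, Polynomial.sum]
    rw [integral_finsetSum _ fun n _ => hint n]
    refine Finset.sum_congr rfl fun n _ => ?_
    have h := (hρ n).2
    dsimp only at h
    rw [integral_const_mul, h, ← integral_complex_ofReal]
    simp
  rw [this]
  exact integral_nonneg fun s => hp s s.2

theorem ae_isStieltjesMomentSeqENN_of_momentMap [SigmaFinite μ]
    (hfin : ∀ n : ℕ, 1 ≤ n → ∀ᵐ x ∂μ, rnIter μ φ n x < ∞)
    (hpos : ∀ p : Polynomial ℂ, (∀ t : ℝ, 0 ≤ t → 0 ≤ p.eval (t : ℂ)) →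
      ∀ᵐ x ∂μ, 0 ≤ (momentMap μ φ p : X → ℂ) x) :
    ∀ᵐ x ∂μ, IsStieltjesMomentSeqENN fun n => rnIter μ φ n x := by
  refine ae_isStieltjesMomentSeqENN_of_forall_polynomial (fun n => ?_) fun p hp => ?_
  · rcases n.eq_zero_or_pos with rfl | hn
    exacts [ae_rnIter_zero_lt_top μ φ, hfin n hn]
  · filter_upwards [hpos (p.map Complex.ofRealHom) fun t ht => by
      have : (p.map Complex.ofRealHom).eval (t : ℂ) = ((p.eval t : ℝ) : ℂ) :=
        Polynomial.eval_map_apply Complex.ofRealHom t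
      rw [this]
      exact_mod_cast hp t ht] with x hx
    rw [momentMap_map_ofReal] at hx
    exact_mod_cast hx

end Equivalence

theorem theorem8p3 {X : Type*} [MeasurableSpace X] (μ : Measure X) [SigmaFinite μ]
    (φ : X → X) (hφ : Measure.QuasiMeasurePreserving φ μ μ) :
    List.TFAE
      [ -- (i)
        GeneratesStieltjes (compositionOp hφ),
        -- (ii)
        ∀ᵐ x ∂μ, IsStieltjesMomentSeqENN fun n => rnIter μ φ n x,
        -- (iii)
        (∀ k : ℕ, 1 ≤ k →
            Dense ((opPow (compositionOp hφ) k).domain : Set (Lp ℂ 2 μ))) ∧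
          ∀ Δ : Set X, MeasurableSet Δ → (∀ k : ℕ, μ (φ^[k] ⁻¹' Δ) < ∞) →
            IsStieltjesMomentSeqENN fun n => μ (φ^[n] ⁻¹' Δ),
        -- (iv)
        (∀ n : ℕ, 1 ≤ n → ∀ᵐ x ∂μ, rnIter μ φ n x < ∞) ∧
          ∀ p : Polynomial ℂ, (∀ t : ℝ, 0 ≤ t → 0 ≤ p.eval (t : ℂ)) →
            ∀ᵐ x ∂μ, 0 ≤ (momentMap μ φ p : X → ℂ) x ] ∧
    (GeneratesStieltjes (compositionOp hφ) →
      ∀ n : ℕ,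
        opPow (compositionOp hφ) n = compositionOp (hφ.iterate n) ∧
        IsCoreFor (smoothVectors (compositionOp hφ)) (opPow (compositionOp hφ) n)) := by
  have of_preimage : (∀ k : ℕ, 1 ≤ k →
      Dense ((opPow (compositionOp hφ) k).domain : Set (Lp ℂ 2 μ))) ∧
        (∀ Δ : Set X, MeasurableSet Δ → (∀ k : ℕ, μ (φ^[k] ⁻¹' Δ) < ∞) →
          IsStieltjesMomentSeqENN fun n => μ (φ^[n] ⁻¹' Δ)) →
      ∀ᵐ x ∂μ, IsStieltjesMomentSeqENN fun n => rnIter μ φ n x := by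
    rintro ⟨hd, hS⟩
    refine ae_isStieltjesMomentSeqENN_of_preimage hφ (fun n => ?_) hS
    rcases n.eq_zero_or_pos with rfl | hn
    exacts [ae_rnIter_zero_lt_top μ φ, ae_rnIter_lt_top_of_dense hφ (hd n hn)]
  have to_preimage : GeneratesStieltjes (compositionOp hφ) → (∀ k : ℕ, 1 ≤ k →
      Dense ((opPow (compositionOp hφ) k).domain : Set (Lp ℂ 2 μ))) ∧
        (∀ Δ : Set X, MeasurableSet Δ → (∀ k : ℕ, μ (φ^[k] ⁻¹' Δ) < ∞) →
          IsStieltjesMomentSeqENN fun n => μ (φ^[n] ⁻¹' Δ)) := fun h =>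
    ⟨fun k _ => h.1.mono (iInf_le (fun n => (opPow (compositionOp hφ) n).domain) k),
      fun _ hΔ hfin => h.isStieltjesMomentSeqENN_preimage hΔ hfin⟩
  refine ⟨?_, fun h n => ?_⟩
  · tfae_have 1 → 3 := to_preimage
    tfae_have 3 → 2 := of_preimage
    tfae_have 2 → 1 := generatesStieltjes_of_ae hφ
    tfae_have 2 → 4 := fun hS =>
      ⟨fun n _ => hS.mono fun x hx => (hx.1 n).lt_top,
        fun p hp => hS.mono fun x hx => momentMap_nonneg hx hp⟩
    tfae_have 4 → 2 := fun h => ae_isStieltjesMomentSeqENN_of_momentMap h.1 h.2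
    tfae_finish
  · have hS := of_preimage (to_preimage h)
    exact ⟨opPow_eq_compositionOp_iterate hφ hS n,
      isCoreFor_smoothVectors hφ (fun j => hS.mono fun x hx => (hx.1 j).lt_top) n⟩
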